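/- **Setting.** Let $\alpha>2$, $P_t,\sigma_P,\sigma_S,d,\beta_t,\beta_e,\lambda_e>0$ and $\epsilon\in(0,1)$. A transmitter is at the origin of $\mathbb{R}^2$ and its receiver is at distance $d$. Eavesdroppers form a homogeneous Poisson point process $\Phi_e$ of density $\lambda_e$. The fading gains $h$ (link to the receiver) and $g_y$ (link to the eavesdropper at $y\in\Phi_e$) are exponential with mean $1$, mutually independent and independent of $\Phi_e$. Let $y^*=\arg\max_{y\in\Phi_e} g_y\|y\|^{-\alpha}$ be the strongest eavesdropper (it exists almost surely) and $G=g_{y^*}\|y^*\|^{-\alpha}$. *Guard zone of radius $r\ge 0$:* the transmitter is active iff no eavesdropper lies in the ball $B(0,r)$. Put $$P_{\rm cov}^{GZ}(r)=\mathbb{P}\Big(\tfrac{P_t h d^{-\alpha}}{\sigma_P^2}\ge\beta_t,\ \Phi_e\cap B(0,r)=\emptyset\Big),\qquad P_{\rm sec}^{GZ}(r)=\mathbb{P}\Big(\tfrac{P_tG}{\sigma_S^2}\le\beta_e\ \Big|\ \Phi_e\cap B(0,r)=\emptyset\Big).$$ Let $r_g^*$ be the $r\ge0$ that maximizes $P_{\rm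 cov}^{GZ}(r)$ subject to $P_{\rm sec}^{GZ}(r)\ge\epsilon$. *Artificial noise with power split $\gamma\in[0,1]$:* put $$P_{\rm cov}^{AN}(\gamma)=\mathbb{P}\Big(\tfrac{\gamma P_t h d^{-\alpha}}{\sigma_P^2}\ge\beta_t\Big),\qquad P_{\rm sec}^{AN}(\gamma)=\mathbb{P}\Big(\tfrac{\gamma P_tG}{(1-\gamma)P_tG+\sigma_S^2}\le\beta_e\Big).$$ Let $\gamma^*$ be the $\gamma\in[0,1]$ that maximizes $P_{\rm cov}^{AN}(\gamma)$ subject to $P_{\rm sec}^{AN}(\gamma)\ge\epsilon$. **Claim.** Put $$\lambda_e^*=\frac{\alpha}{2\pi\,\Gamma(2/\alpha)}\,\log\Big(\frac1\epsilon\Big)\Big(\frac{P_t}{\sigma_S^2\beta_e}\Big)^{-2/\alpha}.$$ The maximizers $r_g^*$ and $\gamma^*$ exist and are unique, and 1. $r_g^*=0$ if and only if $\lambda_e\le\lambda_e^*$; 2. $\gamma^*=1$ if and only if $\lambda_e\le\lambda_e^*$ (the threshold is the same for both techniques); 3. if $\lambda_e\le\lambda_e^*$, the secrecy target is met without either technique: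 $P_{\rm sec}^{GZ}(0)\ge\epsilon$ and $P_{\rm sec}^{AN}(1)\ge\epsilon$; if $\lambda_e<\lambda_e^*$, both inequalities are strict. -/

import Mathlib

open MeasureTheory ProbabilityTheory

noncomputable section

/-- The Euclidean plane; the primary transmitter sits at the origin. -/
abbrev Plane : Type := EuclideanSpace ℝ (Fin 2)

variable {Ω : Type*}

/-- The number of points of the random family `y` lying in `B` (counted with multiplicity). -/
def pointCount (y : ℕ → Ω → Plane) (B : Set Plane) (ω : Ω) : ℕ∞ :=
  {i : ℕ | y i ω ∈ B}.encard

/-- `y` enumerates a homogeneous Poisson point process of density `lam` in the plane: the number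
of points in a Borel set of finite area is Poisson distributed with mean `lam * area`, and the
numbers of points in pairwise disjoint Borel sets are independent.
(For `lam > 0` such a process has almost surely infinitely many points, so that it can be
enumerated by the natural numbers.) -/
structure IsPoissonPointProcess [MeasurableSpace Ω] (P : Measure Ω) (lam : ℝ)
    (y : ℕ → Ω → Plane) : Prop where
  measurable : ∀ i, Measurable (y i)
  hasLaw_count : ∀ B : Set Plane, MeasurableSet B → volume B < ⊤ →
    HasLaw (pointCount y B)
      ((poissonMeasure (lam * volume.real B).toNNReal).map (Nat.cast : ℕ → ℕ∞)) P
  indep_count : ∀ (n : ℕ) (B : Fin n → Set Plane), (∀ k, MeasurableSet (B k)) →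
    Pairwise (fun k l => Disjoint (B k) (B l)) → iIndepFun (fun k => pointCount y (B k)) P

/-- The randomness of the network: eavesdroppers at the points `y i` of a Poisson point process of
density `lam`, and unit-mean exponential power gains (Rayleigh fading) `g i` on the link to the
`i`-th eavesdropper and `h` on the link to the primary receiver; all the gains are mutually
independent and independent of the eavesdropper locations. -/
structure IsEavesdropperNetwork [MeasurableSpace Ω] (P : Measure Ω) (lam : ℝ)
    (y : ℕ → Ω → Plane) (g : ℕ → Ω → ℝ) (h : Ω → ℝ) : Prop where
  poisson : IsPoissonPointProcess P lam y
  measurable_g : ∀ i, Measurable (g i)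
  measurable_h : Measurable h
  hasLaw_g : ∀ i, HasLaw (g i) (expMeasure 1) P
  hasLaw_h : HasLaw h (expMeasure 1) P
  indep_g : iIndepFun g P
  indep_g_y : IndepFun (fun ω i => g i ω) (fun ω i => y i ω) P
  indep_h : IndepFun h (fun ω => ((fun i => g i ω), (fun i => y i ω))) P

/-- The channel gain `g_y ‖y‖^(-α)` at the `i`-th eavesdropper. -/
def eveGain (α : ℝ) (y : ℕ → Ω → Plane) (g : ℕ → Ω → ℝ) (i : ℕ) (ω : Ω) : ℝ :=
  g i ω * ‖y i ω‖ ^ (-α)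

/-- The index of the strongest eavesdropper `y* = argmax g_y ‖y‖^(-α)`. (The maximum is attained
almost surely; on the exceptional null set the index is arbitrary.) -/
def strongest (α : ℝ) (y : ℕ → Ω → Plane) (g : ℕ → Ω → ℝ) (ω : Ω) : ℕ :=
  Classical.epsilon fun i : ℕ => ∀ j, eveGain α y g j ω ≤ eveGain α y g i ω

/-- The channel gain at the strongest eavesdropper. -/
def strongestGain (α : ℝ) (y : ℕ → Ω → Plane) (g : ℕ → Ω → ℝ) (ω : Ω) : ℝ :=
  eveGain α y g (strongest α y g ω) ω

/-! ### Guard zone technique -/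

/-- The event that the transmitter is active: no eavesdropper in the guard zone of radius `r`. -/
def activeGZ (y : ℕ → Ω → Plane) (r : ℝ) : Set Ω :=
  {ω | pointCount y (Metric.ball 0 r) ω = 0}

/-- The SNR at the primary receiver, at distance `d`, with guard zone. -/
def snrP_GZ (Pt σP α d : ℝ) (h : Ω → ℝ) (ω : Ω) : ℝ :=
  Pt * h ω * d ^ (-α) / σP ^ 2

/-- The SNR at the strongest eavesdropper with guard zone. -/
def snrS_GZ (Pt σS α : ℝ) (y : ℕ → Ω → Plane) (g : ℕ → Ω → ℝ) (ω : Ω) : ℝ :=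
  Pt * strongestGain α y g ω / σS ^ 2

/-- Coverage probability with a guard zone of radius `r`: `ℙ(SNR_P ≥ βt, active)`. -/
def covGZ [MeasurableSpace Ω] (P : Measure Ω) (Pt σP α d βt : ℝ)
    (y : ℕ → Ω → Plane) (h : Ω → ℝ) (r : ℝ) : ℝ :=
  P.real ({ω | βt ≤ snrP_GZ Pt σP α d h ω} ∩ activeGZ y r)

/-- Secure communication probability with a guard zone of radius `r`:
`ℙ(SNR_S ≤ βe | active)`. -/
def secGZ [MeasurableSpace Ω] (P : Measure Ω) (Pt σS α βe : ℝ)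
    (y : ℕ → Ω → Plane) (g : ℕ → Ω → ℝ) (r : ℝ) : ℝ :=
  (P[|activeGZ y r]).real {ω | snrS_GZ Pt σS α y g ω ≤ βe}

/-- `r` maximizes the coverage probability among the guard zone radii whose secure communication
probability is at least `ε`. -/
def IsOptimalRadius [MeasurableSpace Ω] (P : Measure Ω) (Pt σP σS α d βt βe ε : ℝ)
    (y : ℕ → Ω → Plane) (g : ℕ → Ω → ℝ) (h : Ω → ℝ) (r : ℝ) : Prop :=
  (0 ≤ r ∧ ε ≤ secGZ P Pt σS α βe y g r) ∧
    ∀ r' : ℝ, 0 ≤ r' → ε ≤ secGZ P Pt σS α βe y g r' →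
      covGZ P Pt σP α d βt y h r' ≤ covGZ P Pt σP α d βt y h r

/-! ### Artificial noise technique -/

/-- The SNR at the primary receiver when the fraction `γ` of the power carries information. The
receiver removes the artificial noise. -/
def snrP_AN (Pt σP α d : ℝ) (h : Ω → ℝ) (γ : ℝ) (ω : Ω) : ℝ :=
  γ * Pt * h ω * d ^ (-α) / σP ^ 2

/-- The SNR at the strongest eavesdropper when the fraction `1 - γ` of the power is artificial
noise. -/
def snrS_AN (Pt σS α : ℝ) (y : ℕ → Ω → Plane) (g : ℕ → Ω → ℝ) (γ : ℝ) (ω : Ω) : ℝ :=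
  γ * Pt * strongestGain α y g ω / ((1 - γ) * Pt * strongestGain α y g ω + σS ^ 2)

/-- Coverage probability with power split `γ` (the transmitter is always active). -/
def covAN [MeasurableSpace Ω] (P : Measure Ω) (Pt σP α d βt : ℝ) (h : Ω → ℝ) (γ : ℝ) : ℝ :=
  P.real {ω | βt ≤ snrP_AN Pt σP α d h γ ω}

/-- Secure communication probability with power split `γ`. -/
def secAN [MeasurableSpace Ω] (P : Measure Ω) (Pt σS α βe : ℝ)
    (y : ℕ → Ω → Plane) (g : ℕ → Ω → ℝ) (γ : ℝ) : ℝ :=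
  P.real {ω | snrS_AN Pt σS α y g γ ω ≤ βe}

/-- `γ` maximizes the coverage probability among the power splits whose secure communication
probability is at least `ε`. -/
def IsOptimalSplit [MeasurableSpace Ω] (P : Measure Ω) (Pt σP σS α d βt βe ε : ℝ)
    (y : ℕ → Ω → Plane) (g : ℕ → Ω → ℝ) (h : Ω → ℝ) (γ : ℝ) : Prop :=
  (γ ∈ Set.Icc (0 : ℝ) 1 ∧ ε ≤ secAN P Pt σS α βe y g γ) ∧
    ∀ γ' ∈ Set.Icc (0 : ℝ) 1, ε ≤ secAN P Pt σS α βe y g γ' →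
      covAN P Pt σP α d βt h γ' ≤ covAN P Pt σP α d βt h γ

/-- The threshold `λ_e^*` on the density of eavesdroppers. -/
def densityThreshold (Pt σS α βe ε : ℝ) : ℝ :=
  α / (2 * Real.pi * Real.Gamma (2 / α)) * Real.log (1 / ε) *
    (Pt / (σS ^ 2 * βe)) ^ (-(2 / α))

end

/-! The eavesdroppers together with their gains form a marked Poisson process: the probability that
no pair (location, gain) lies in `A` is `exp(-lam * m(A))`, where `m` is area times the unit
exponential law (`measure_forall_notMem`). Let `A` collect the pairs with location in the ball of
radius `r` or with channel gain above `t`. Then "active and strongest gain at most `t`" has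
probability `exp(-lam * (π r ^ 2 + eveTail α t r))`, by integration over slices and polar
coordinates (`prod_badMarks`).

Write `S = βe * σS ^ 2 / Pt`. Conditioning on activity cancels `π r ^ 2`, so guard-zone secrecy is
`exp(-lam * eveTail α S r)`. With artificial noise, the eavesdropper's SNR is at most `βe` iff `u *
G ≤ S` with `u = γ * (1 + βe) - βe`. Hence secrecy is certain for `u ≤ 0`, and otherwise it is the
same exponential at level `S / u` and radius `0`. At `r = 0` and at `γ = 1` both techniques give
`exp(-lam * eveTail α S 0)`. A Gamma integral evaluates this, and comparison with `ε` gives the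
common threshold.

Coverage strictly decreases in `r` and strictly increases in `γ`, so the optimum is the least
feasible radius or the greatest feasible split. It equals `0` or `1` exactly when that endpoint is
feasible.

The void probability is derived from the counts alone. The Laplace functional is computed for simple
functions and extended by limits. Fixing the locations and using independence of the gains then
turns the void probability into a Laplace functional. -/

open Filter Topology
open scoped ENNReal NNReal

/-! ### Exponentials on `[0, ∞]` and the Laplace functional of the Poisson process -/

section

/-- The function `a ↦ e^(-a)` on `[0, ∞]`. -/
noncomputable def expNeg (a : ℝ≥0∞) : ℝ≥0∞ := (EReal.exp a)⁻¹

@[simp] lemma expNeg_zero : expNeg 0 = 1 := by simp [expNeg]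

@[simp] lemma expNeg_top : expNeg ∞ = 0 := by simp [expNeg]

lemma expNeg_add (a b : ℝ≥0∞) : expNeg (a + b) = expNeg a * expNeg b := by
  have h (a : ℝ≥0∞) : EReal.exp a ≠ 0 := by simp
  rw [expNeg, EReal.coe_ennreal_add, EReal.exp_add, ENNReal.mul_inv (.inl (h a)) (.inr (h b))]
  rfl

lemma expNeg_sum {ι : Type*} (s : Finset ι) (f : ι → ℝ≥0∞) :
    expNeg (∑ i ∈ s, f i) = ∏ i ∈ s, expNeg (f i) := by
  induction s using Finset.cons_induction with
  | empty => simp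
  | cons i s hi ih => rw [Finset.sum_cons, Finset.prod_cons, expNeg_add, ih]

lemma expNeg_nat_mul (n : ℕ) (a : ℝ≥0∞) : expNeg (n * a) = expNeg a ^ n := by
  simpa using expNeg_sum (Finset.range n) (fun _ => a)

lemma continuous_expNeg : Continuous expNeg :=
  continuous_inv.comp (ENNReal.continuous_exp.comp continuous_coe_ennreal_ereal)

lemma measurable_expNeg : Measurable expNeg := continuous_expNeg.measurable

lemma expNeg_antitone : Antitone expNeg := fun _ _ hab =>
  ENNReal.inv_le_inv.2 (EReal.exp_monotone (EReal.coe_ennreal_le_coe_ennreal_iff.2 hab))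

lemma expNeg_le_one (a : ℝ≥0∞) : expNeg a ≤ 1 := by
  simpa using expNeg_antitone (show 0 ≤ a from zero_le)

lemma expNeg_ofReal {x : ℝ} (hx : 0 ≤ x) :
    expNeg (ENNReal.ofReal x) = ENNReal.ofReal (Real.exp (-x)) := by
  rw [expNeg, EReal.coe_ennreal_ofReal, max_eq_left hx, EReal.exp_coe,
    ← ENNReal.ofReal_inv_of_pos (Real.exp_pos _), Real.exp_neg]

/-- The inverse `b ↦ -log b` of `expNeg` on `[0, 1]`. -/
noncomputable def negLog (b : ℝ≥0∞) : ℝ≥0∞ := (-ENNReal.log b).toENNReal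

lemma measurable_negLog : Measurable negLog := by
  unfold negLog; fun_prop

lemma expNeg_negLog {b : ℝ≥0∞} (hb : b ≤ 1) : expNeg (negLog b) = b := by
  have h : (0 : EReal) ≤ -ENNReal.log b := by
    rw [EReal.le_neg, neg_zero]
    exact ENNReal.log_le_zero_iff.2 hb
  rw [expNeg, negLog, EReal.coe_toENNReal h, EReal.exp_neg, ENNReal.exp_log, inv_inv]

/-- The probability generating function of the Poisson distribution. -/
lemma lintegral_expNeg_mul_poisson {Ω : Type*} [MeasurableSpace Ω] {P : Measure Ω} {m : ℝ≥0}
    {N : Ω → ℕ∞} (hN : HasLaw N ((poissonMeasure m).map (Nat.cast : ℕ → ℕ∞)) P) (a : ℝ≥0∞) :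
    ∫⁻ ω, expNeg (a * (N ω : ℝ≥0∞)) ∂P = expNeg (m * (1 - expNeg a)) := by
  have hF : Measurable fun k : ℕ∞ => expNeg (a * (k : ℝ≥0∞)) := measurable_of_countable _
  calc ∫⁻ ω, expNeg (a * (N ω : ℝ≥0∞)) ∂P
      = ∫⁻ k : ℕ, expNeg (a * ((k : ℕ∞) : ℝ≥0∞)) ∂(poissonMeasure m) := by
        rw [← lintegral_map hF (measurable_of_countable (Nat.cast : ℕ → ℕ∞)), ← hN.map_eq,
          lintegral_map' hF.aemeasurable hN.aemeasurable]
    _ = ∑' k : ℕ, expNeg a ^ k * poissonMeasure m {k} := by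
        rw [lintegral_countable']
        refine tsum_congr fun k => ?_
        rw [ENat.toENNReal_coe, mul_comm a, expNeg_nat_mul]
    _ = expNeg (m * (1 - expNeg a)) := by
        obtain ⟨b, hb⟩ := WithTop.ne_top_iff_exists.1
          ((expNeg_le_one a).trans_lt ENNReal.one_lt_top).ne
        change (b : ℝ≥0∞) = _ at hb
        have hb1 : b ≤ 1 := by
          have := expNeg_le_one a
          rw [← hb] at this; exact_mod_cast this
        have hterm (k : ℕ) : (b : ℝ≥0∞) ^ k * poissonMeasure m {k} =
            ENNReal.ofReal (Real.exp (-m) * ((m * b : ℝ) ^ k / k.factorial)) := by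
          rw [poissonMeasure_singleton, ← ENNReal.ofReal_coe_nnreal,
            ← ENNReal.ofReal_pow b.coe_nonneg, ← ENNReal.ofReal_mul (by positivity)]
          congr 1
          rw [mul_pow]; ring
        have hs := (NormedSpace.expSeries_div_hasSum_exp (m * b : ℝ)).mul_left (Real.exp (-m))
        rw [← Real.exp_eq_exp_ℝ] at hs
        rw [← hb, tsum_congr hterm,
          ← ENNReal.ofReal_tsum_of_nonneg (fun k => by positivity) hs.summable, hs.tsum_eq,
          ← Real.exp_add]
        have : (m * (1 - b) : ℝ≥0∞) = ENNReal.ofReal (m * (1 - b)) := by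
          rw [ENNReal.ofReal_mul m.coe_nonneg, ENNReal.ofReal_sub _ b.coe_nonneg]
          simp
        rw [this, expNeg_ofReal (mul_nonneg m.coe_nonneg (sub_nonneg.2 (by exact_mod_cast hb1)))]
        congr 2; ring

variable {Ω : Type*}

lemma pointCount_eq_count_map (y : ℕ → Ω → Plane) {B : Set Plane} (hB : MeasurableSet B) (ω : Ω) :
    (pointCount y B ω : ℝ≥0∞) = (Measure.count.map fun i => y i ω) B := by
  rw [Measure.map_apply (measurable_of_countable _) hB, Measure.count_apply (by measurability)]
  rfl

lemma pointCount_eq_tsum (y : ℕ → Ω → Plane) {B : Set Plane} (hB : MeasurableSet B) (ω : Ω) :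
    (pointCount y B ω : ℝ≥0∞) = ∑' i, B.indicator 1 (y i ω) := by
  rw [pointCount_eq_count_map y hB, ← lintegral_indicator_one hB,
    lintegral_map (measurable_one.indicator hB) (measurable_of_countable _), lintegral_count]

/-- The value `0` is left out because its level set may have infinite area, where the law of the
count is not prescribed. -/
lemma SimpleFunc.tsum_comp_eq (y : ℕ → Ω → Plane) (s : SimpleFunc Plane ℝ≥0∞) (ω : Ω) :
    ∑' i, s (y i ω) = ∑ v ∈ s.range.filter (· ≠ 0), v * (pointCount y (s ⁻¹' {v}) ω : ℝ≥0∞) := by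
  rw [← lintegral_count, ← lintegral_map (f := s) (g := fun i => y i ω) s.measurable
    (measurable_of_countable _), SimpleFunc.lintegral_eq_lintegral,
    SimpleFunc.lintegral_eq_of_subset' (s := s.range.filter (· ≠ 0)) _ (by
      intro v hv; simpa [Finset.mem_sdiff] using hv)]
  refine Finset.sum_congr rfl fun v _ => ?_
  rw [pointCount_eq_count_map y (s.measurableSet_preimage _)]

lemma SimpleFunc.lintegral_one_sub_expNeg (s : SimpleFunc Plane ℝ≥0∞) :
    ∫⁻ x, (1 - expNeg (s x)) =
      ∑ v ∈ s.range.filter (· ≠ 0), (1 - expNeg v) * volume (s ⁻¹' {v}) := by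
  have h := SimpleFunc.map_lintegral (fun v => 1 - expNeg v) s (μ := volume)
  rw [← SimpleFunc.lintegral_eq_lintegral] at h
  simp only [SimpleFunc.map_apply] at h
  rw [h]
  symm
  refine Finset.sum_subset (Finset.filter_subset _ _) fun v hv hv' => ?_
  have : v = 0 := by
    by_contra h0
    exact hv' (Finset.mem_filter.2 ⟨hv, h0⟩)
  simp [this]

variable [MeasurableSpace Ω] {P : Measure Ω} {lam : ℝ} {y : ℕ → Ω → Plane}

lemma IsPoissonPointProcess.measurable_pointCount (hy : IsPoissonPointProcess P lam y)
    {B : Set Plane} (hB : MeasurableSet B) :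
    Measurable fun ω => (pointCount y B ω : ℝ≥0∞) := by
  simp only [pointCount_eq_tsum y hB]
  exact Measurable.tsum fun i => (measurable_one.indicator hB).comp (hy.measurable i)

/-- The level sets of `s` are disjoint, so their counts are independent Poisson variables. The
expectation therefore factors into Poisson generating functions, one for each nonzero value. -/
lemma IsPoissonPointProcess.laplace_simpleFunc (hlam : 0 ≤ lam) (hy : IsPoissonPointProcess P lam y)
    (s : SimpleFunc Plane ℝ≥0∞) (hs : ∀ v ≠ 0, volume (s ⁻¹' {v}) < ∞) :
    ∫⁻ ω, expNeg (∑' i, s (y i ω)) ∂P =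
      expNeg (ENNReal.ofReal lam * ∫⁻ x, (1 - expNeg (s x))) := by
  set T := s.range.filter (· ≠ 0)
  let e := T.equivFin
  have hT (k : Fin T.card) : ((e.symm k : ℝ≥0∞)) ≠ 0 := (Finset.mem_filter.1 (e.symm k).2).2
  have hsum {M : Type} [AddCommMonoid M] (F : ℝ≥0∞ → M) : ∑ v ∈ T, F v = ∑ k, F (e.symm k) := by
    rw [← Finset.sum_coe_sort T F]
    exact (e.symm.sum_comp (fun v => F v)).symm
  have hind := hy.indep_count T.card (fun k => s ⁻¹' {(e.symm k : ℝ≥0∞)})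
    (fun k => s.measurableSet_preimage _) (fun k l hkl => by
      refine Disjoint.preimage _ (Set.disjoint_singleton.2 fun h => hkl ?_)
      exact e.symm.injective (Subtype.ext h))
  have hind' := hind.comp (fun k n => expNeg ((e.symm k : ℝ≥0∞) * (n : ℝ≥0∞)))
    (fun k => measurable_of_countable _)
  have hprod := lintegral_prod_eq_prod_lintegral_of_indepFun Finset.univ _ hind'
    (fun k => measurable_expNeg.comp
      ((hy.measurable_pointCount (s.measurableSet_preimage _)).const_mul _))
  simp only [Function.comp_apply] at hprod
  have hT' : s.range.filter (· ≠ 0) = T := rfl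
  simp only [SimpleFunc.tsum_comp_eq y s, SimpleFunc.lintegral_one_sub_expNeg, Finset.mul_sum,
    hT', hsum, expNeg_sum, hprod]
  refine Finset.prod_congr rfl fun k _ => ?_
  have hfin := hs _ (hT k)
  rw [lintegral_expNeg_mul_poisson (hy.hasLaw_count _ (s.measurableSet_preimage _) hfin)]
  congr 1
  have : (((lam * volume.real (s ⁻¹' {(e.symm k : ℝ≥0∞)})).toNNReal : ℝ≥0) : ℝ≥0∞) =
      ENNReal.ofReal lam * volume (s ⁻¹' {(e.symm k : ℝ≥0∞)}) := by
    change ENNReal.ofReal _ = _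
    rw [ENNReal.ofReal_mul hlam, ofReal_measureReal hfin.ne]
  rw [this]; ring

/-- Cutting the standard approximations off outside the ball of radius `n` makes every nonzero level
set finite in area and preserves monotonicity in `n`. -/
lemma exists_simpleFunc_approx {w : Plane → ℝ≥0∞} (hw : Measurable w) :
    ∃ s : ℕ → SimpleFunc Plane ℝ≥0∞, (∀ n, ∀ v ≠ 0, volume (s n ⁻¹' {v}) < ∞) ∧
      (∀ x, Monotone fun n => s n x) ∧ ∀ x, Tendsto (fun n => s n x) atTop (𝓝 (w x)) := by
  have hval (n : ℕ) (x : Plane) : (SimpleFunc.eapprox w n).restrict (Metric.ball 0 n) x =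
      (Metric.ball 0 (n : ℝ)).indicator (SimpleFunc.eapprox w n) x := by
    rw [SimpleFunc.restrict_apply _ measurableSet_ball]
  refine ⟨fun n => (SimpleFunc.eapprox w n).restrict (Metric.ball 0 n), fun n v hv => ?_,
    fun x m n hmn => ?_, fun x => ?_⟩
  · refine (measure_mono fun x hx => ?_).trans_lt (measure_ball_lt_top (x := (0 : Plane)) (r := n))
    by_contra hx'
    refine hv ?_
    rw [← Set.mem_singleton_iff.1 (Set.mem_preimage.1 hx), hval, Set.indicator_of_notMem hx']
  · simp only [hval]
    refine (Set.indicator_le_indicator (SimpleFunc.monotone_eapprox w hmn x)).trans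
      (Set.indicator_le_indicator_of_subset (Metric.ball_subset_ball (by exact_mod_cast hmn))
        (fun _ => zero_le) x)
  · refine (SimpleFunc.tendsto_eapprox hw x).congr' ?_
    obtain ⟨N, hN⟩ := exists_nat_gt ‖x‖
    filter_upwards [eventually_ge_atTop N] with n hn
    rw [hval, Set.indicator_of_mem]
    simpa using hN.trans_le (by exact_mod_cast hn)

/-- The Laplace functional of a homogeneous Poisson point process. -/
lemma IsPoissonPointProcess.laplace [IsProbabilityMeasure P] (hlam : 0 ≤ lam)
    (hy : IsPoissonPointProcess P lam y) {w : Plane → ℝ≥0∞} (hw : Measurable w) :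
    ∫⁻ ω, expNeg (∑' i, w (y i ω)) ∂P =
      expNeg (ENNReal.ofReal lam * ∫⁻ x, (1 - expNeg (w x))) := by
  obtain ⟨s, hfin, hmono, hlim⟩ := exists_simpleFunc_approx hw
  have hmeas (n : ℕ) : Measurable fun ω => expNeg (∑' i, s n (y i ω)) :=
    measurable_expNeg.comp (Measurable.tsum fun i => (s n).measurable.comp (hy.measurable i))
  have hL : Tendsto (fun n => ∫⁻ ω, expNeg (∑' i, s n (y i ω)) ∂P) atTop
      (𝓝 (∫⁻ ω, expNeg (∑' i, w (y i ω)) ∂P)) := by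
    -- The constant `1` dominates. Continuity of `expNeg` on all of `[0, ∞]` covers the outcomes
    -- where the limiting sum is infinite.
    refine tendsto_lintegral_of_dominated_convergence (fun _ => 1) hmeas
      (fun n => ae_of_all _ fun ω => expNeg_le_one _) (by simp) (ae_of_all _ fun ω => ?_)
    refine (continuous_expNeg.tendsto _).comp ?_
    simp only [← lintegral_count]
    exact lintegral_tendsto_of_tendsto_of_monotone
      (fun n => (measurable_of_countable _).aemeasurable)
      (ae_of_all _ fun i => hmono (y i ω)) (ae_of_all _ fun i => hlim (y i ω))
  have hR : Tendsto (fun n => expNeg (ENNReal.ofReal lam * ∫⁻ x, (1 - expNeg (s n x)))) atTop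
      (𝓝 (expNeg (ENNReal.ofReal lam * ∫⁻ x, (1 - expNeg (w x))))) := by
    refine (continuous_expNeg.tendsto _).comp
      (ENNReal.Tendsto.const_mul ?_ (.inr ENNReal.ofReal_ne_top))
    -- The integrands `1 - e^(-s n x)` increase with `n`, so monotone convergence applies even if
    -- the limit integral is infinite.
    refine lintegral_tendsto_of_tendsto_of_monotone
      (fun n => (measurable_const.sub (measurable_expNeg.comp (s n).measurable)).aemeasurable)
      (ae_of_all _ fun x m n hmn => tsub_le_tsub_left (expNeg_antitone (hmono x hmn)) 1)
      (ae_of_all _ fun x => ?_)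
    exact ENNReal.Tendsto.sub tendsto_const_nhds
      ((continuous_expNeg.tendsto _).comp (hlim x)) (.inl ENNReal.one_ne_top)
  refine tendsto_nhds_unique hL (hR.congr fun n => ?_)
  exact (hy.laplace_simpleFunc hlam (s n) (hfin n)).symm

end

/-! ### Void probabilities and local finiteness of the marked process -/

section

instance : IsProbabilityMeasure (expMeasure 1) := isProbabilityMeasure_expMeasure one_pos

lemma expMeasure_one_Ioi {x : ℝ} (hx : 0 ≤ x) :
    expMeasure 1 (Set.Ioi x) = ENNReal.ofReal (Real.exp (-x)) := by
  have h := cdf_expMeasure_eq one_pos x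
  rw [if_pos hx, one_mul, cdf_eq_real] at h
  rw [← Set.compl_Iic, ← ofReal_measureReal, probReal_compl_eq_one_sub measurableSet_Iic, h]
  congr 1; ring

lemma expMeasure_one_Ici {x : ℝ} (hx : 0 ≤ x) :
    expMeasure 1 (Set.Ici x) = ENNReal.ofReal (Real.exp (-x)) := by
  have hac : expMeasure 1 ≪ volume := withDensity_absolutelyContinuous _ _
  rw [← expMeasure_one_Ioi hx]
  exact measure_congr (hac.ae_eq (Ioi_ae_eq_Ici (μ := volume)).symm)

/-- The probability that independent random variables all lie in prescribed sets. -/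
lemma iIndepFun.measure_forall_mem {Ω β : Type*} [MeasurableSpace Ω] [MeasurableSpace β]
    {P : Measure Ω} [IsProbabilityMeasure P] {g : ℕ → Ω → β} {ν : Measure β}
    (hg : iIndepFun g P) (hmg : ∀ i, Measurable (g i)) (hlaw : ∀ i, P.map (g i) = ν)
    {B : ℕ → Set β} (hB : ∀ i, MeasurableSet (B i)) :
    P {ω | ∀ i, g i ω ∈ B i} = expNeg (∑' i, negLog (ν (B i))) := by
  have hle (i : ℕ) : ν (B i) ≤ 1 := by
    rw [← hlaw i, Measure.map_apply (hmg i) (hB i)]; exact prob_le_one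
  have hset : {ω | ∀ i, g i ω ∈ B i} = ⋂ n : ℕ, ⋂ i ∈ Finset.range n, g i ⁻¹' B i := by
    ext ω
    simp only [Set.mem_ofPred_eq, Set.mem_iInter, Finset.mem_range, Set.mem_preimage]
    exact ⟨fun h _ i _ => h i, fun h i => h (i + 1) i i.lt_succ_self⟩
  have hfin (n : ℕ) : P (⋂ i ∈ Finset.range n, g i ⁻¹' B i) =
      expNeg (∑ i ∈ Finset.range n, negLog (ν (B i))) := by
    rw [hg.measure_inter_preimage_eq_mul _ (fun i _ => hB i), expNeg_sum]
    refine Finset.prod_congr rfl fun i _ => ?_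
    rw [expNeg_negLog (hle i), ← hlaw i, Measure.map_apply (hmg i) (hB i)]
  have hlim := tendsto_measure_iInter_atTop (μ := P)
    (s := fun n : ℕ => ⋂ i ∈ Finset.range n, g i ⁻¹' B i)
    (fun n => (Finset.measurableSet_biInter _ fun i _ => hmg i (hB i)).nullMeasurableSet)
    (fun m n hmn => Set.biInter_mono (fun i hi => Finset.range_mono hmn hi) fun _ _ => le_rfl)
    ⟨0, measure_ne_top _ _⟩
  rw [← hset] at hlim
  refine tendsto_nhds_unique hlim ?_
  refine ((continuous_expNeg.tendsto _).comp ENNReal.summable.hasSum.tendsto_sum_nat).congr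
    fun n => ?_
  exact (hfin n).symm

variable {Ω : Type*} [MeasurableSpace Ω] {P : Measure Ω} {lam : ℝ} {y : ℕ → Ω → Plane}
  {g : ℕ → Ω → ℝ} {h : Ω → ℝ}

lemma lintegral_natCast_poissonMeasure (m : ℝ≥0) :
    ∫⁻ k : ℕ, (k : ℝ≥0∞) ∂(poissonMeasure m) = m := by
  -- The weights satisfy `(k + 1) p (k + 1) = m p k`, so the mean is `m` times the total mass.
  have hstep (k : ℕ) : ((k + 1 : ℕ) : ℝ≥0∞) * poissonMeasure m {k + 1} =
      m * poissonMeasure m {k} := by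
    rw [poissonMeasure_singleton, poissonMeasure_singleton, ← ENNReal.ofReal_coe_nnreal,
      ← ENNReal.ofReal_natCast, ← ENNReal.ofReal_mul (by positivity),
      ← ENNReal.ofReal_mul (by positivity)]
    congr 1
    rw [Nat.factorial_succ]
    push_cast
    field_simp
    ring
  have htot : ∑' k : ℕ, poissonMeasure m {k} = 1 := by
    have := lintegral_countable' (μ := poissonMeasure m) (fun _ => 1)
    simpa using this.symm
  rw [lintegral_countable', tsum_eq_zero_add' ENNReal.summable]
  simp only [hstep, ENNReal.tsum_mul_left, htot]
  simp

/-- The intensity measure of a homogeneous Poisson point process. -/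
lemma IsPoissonPointProcess.sum_map_eq (hlam : 0 ≤ lam) (hy : IsPoissonPointProcess P lam y) :
    Measure.sum (fun i => P.map (y i)) = ENNReal.ofReal lam • volume := by
  have hval {B : Set Plane} (hB : MeasurableSet B) (hfin : volume B < ∞) :
      Measure.sum (fun i => P.map (y i)) B = ENNReal.ofReal lam * volume B := by
    have hF : Measurable fun k : ℕ∞ => (k : ℝ≥0∞) := measurable_of_countable _
    have hlaw := hy.hasLaw_count B hB hfin
    calc Measure.sum (fun i => P.map (y i)) B
        = ∫⁻ ω, (pointCount y B ω : ℝ≥0∞) ∂P := by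
          rw [Measure.sum_apply _ hB]
          simp only [pointCount_eq_tsum y hB]
          rw [lintegral_tsum (f := fun i ω => B.indicator 1 (y i ω))
            (fun i => ((measurable_one.indicator hB).comp (hy.measurable i)).aemeasurable)]
          refine tsum_congr fun i => ?_
          rw [← lintegral_map (measurable_one.indicator hB) (hy.measurable i),
            lintegral_indicator_one hB]
      _ = ∫⁻ k : ℕ, (k : ℝ≥0∞) ∂(poissonMeasure (lam * volume.real B).toNNReal) := by
          rw [← lintegral_map' hF.aemeasurable hlaw.aemeasurable, hlaw.map_eq,
            lintegral_map hF (measurable_of_countable _)]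
          simp
      _ = ENNReal.ofReal lam * volume B := by
          rw [lintegral_natCast_poissonMeasure]
          change ENNReal.ofReal _ = _
          rw [ENNReal.ofReal_mul hlam, ofReal_measureReal hfin.ne]
  -- Counts are controlled only on sets of finite area, so the two measures are compared on balls
  -- exhausting the plane.
  refine Measure.ext_of_iUnion_eq_univ (Metric.iUnion_ball_nat (0 : Plane)) fun n => ?_
  ext B hB
  rw [Measure.restrict_apply hB, Measure.restrict_apply hB,
    hval (hB.inter measurableSet_ball)
      ((measure_mono Set.inter_subset_right).trans_lt measure_ball_lt_top)]
  rfl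

namespace IsEavesdropperNetwork

lemma measurable_locations (hnet : IsEavesdropperNetwork P lam y g h) :
    Measurable fun ω i => y i ω := measurable_pi_lambda _ hnet.poisson.measurable

lemma measurable_gains (hnet : IsEavesdropperNetwork P lam y g h) :
    Measurable fun ω i => g i ω := measurable_pi_lambda _ hnet.measurable_g

variable [IsProbabilityMeasure P]

/-- The void probabilities of the Poisson point process marked by the gains. -/
lemma measure_forall_notMem (hlam : 0 ≤ lam) (hnet : IsEavesdropperNetwork P lam y g h)
    {A : Set (Plane × ℝ)} (hA : MeasurableSet A) :
    P {ω | ∀ i, (y i ω, g i ω) ∉ A} =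
      expNeg (ENNReal.ofReal lam * (volume.prod (expMeasure 1)) A) := by
  let E : Set ((ℕ → ℝ) × (ℕ → Plane)) := {p | ∀ i, (p.2 i, p.1 i) ∉ A}
  have hE : MeasurableSet E := by
    have : E = ⋂ i, (fun p : (ℕ → ℝ) × (ℕ → Plane) => (p.2 i, p.1 i)) ⁻¹' Aᶜ := by
      ext p; simp [E]
    rw [this]
    exact MeasurableSet.iInter fun i => hA.compl.preimage (by fun_prop)
  let q (x : Plane) : ℝ≥0∞ := expMeasure 1 (Prod.mk x ⁻¹' A)
  have hq : Measurable q := measurable_measure_prodMk_left hA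
  have hq1 (x : Plane) : expMeasure 1 (Prod.mk x ⁻¹' Aᶜ) = 1 - q x := by
    rw [Set.preimage_compl, prob_compl_eq_one_sub (measurable_prodMk_left hA)]
  -- With the locations frozen at `η`, the independent gains avoid their slices with probability `∏
  -- (1 - q (η i))`, written as an exponential of a sum.
  have hsec (η : ℕ → Plane) : (P.map fun ω i => g i ω) ((fun γ => (γ, η)) ⁻¹' E) =
      expNeg (∑' i, negLog (1 - q (η i))) := by
    rw [Measure.map_apply hnet.measurable_gains (measurable_prodMk_right hE)]
    have := iIndepFun.measure_forall_mem hnet.indep_g hnet.measurable_g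
      (fun i => (hnet.hasLaw_g i).map_eq) (B := fun i => Prod.mk (η i) ⁻¹' Aᶜ)
      (fun i => measurable_prodMk_left hA.compl)
    simp only [hq1] at this
    exact this
  have hw : Measurable fun x => negLog (1 - q x) :=
    measurable_negLog.comp (measurable_const.sub hq)
  have hmap := hnet.indep_g_y.map_prod_eq_prod_map_map hnet.measurable_gains.aemeasurable
    hnet.measurable_locations.aemeasurable
  calc P {ω | ∀ i, (y i ω, g i ω) ∉ A}
      = (P.map fun ω => ((fun i => g i ω), (fun i => y i ω))) E := by
        rw [Measure.map_apply (hnet.measurable_gains.prodMk hnet.measurable_locations) hE]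
        rfl
    _ = ∫⁻ ω, expNeg (∑' i, negLog (1 - q (y i ω))) ∂P := by
        rw [hmap, Measure.prod_apply_symm hE]
        simp only [hsec]
        rw [lintegral_map _ hnet.measurable_locations]
        exact measurable_expNeg.comp
          (Measurable.tsum fun i => hw.comp (measurable_pi_apply i))
    _ = expNeg (ENNReal.ofReal lam * (volume.prod (expMeasure 1)) A) := by
        rw [hnet.poisson.laplace hlam hw, Measure.prod_apply hA]
        congr 2
        -- The weight was chosen as `w = -log (1 - q)`, so that `1 - e^(-w) = q`, whose integral is
        -- the product measure of `A`.
        refine lintegral_congr fun x => ?_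
        rw [expNeg_negLog tsub_le_self, ENNReal.sub_sub_cancel ENNReal.one_ne_top prob_le_one]

/-- First Borel–Cantelli lemma: each gain is independent of its location, so the probabilities sum
to the intensity `lam` times the product measure of `A`, which is finite. -/
lemma ae_finite_setOf_mem (hlam : 0 ≤ lam) (hnet : IsEavesdropperNetwork P lam y g h)
    {A : Set (Plane × ℝ)} (hA : MeasurableSet A) (hfin : (volume.prod (expMeasure 1)) A ≠ ∞) :
    ∀ᵐ ω ∂P, {i | (y i ω, g i ω) ∈ A}.Finite := by
  refine ae_finite_setOfPred_mem (s := fun i => {ω | (y i ω, g i ω) ∈ A}) ?_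
  have hterm (i : ℕ) : P {ω | (y i ω, g i ω) ∈ A} =
      ∫⁻ x, expMeasure 1 (Prod.mk x ⁻¹' A) ∂(P.map (y i)) := by
    have hind : IndepFun (y i) (g i) P :=
      (hnet.indep_g_y.comp (measurable_pi_apply i) (measurable_pi_apply i)).symm
    have hmap := hind.map_prod_eq_prod_map_map (hnet.poisson.measurable i).aemeasurable
      (hnet.measurable_g i).aemeasurable
    rw [(hnet.hasLaw_g i).map_eq] at hmap
    rw [← Measure.prod_apply hA, ← hmap,
      Measure.map_apply ((hnet.poisson.measurable i).prodMk (hnet.measurable_g i)) hA]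
    rfl
  simp only [hterm]
  rw [← lintegral_sum_measure, hnet.poisson.sum_map_eq hlam, lintegral_smul_measure,
    ← Measure.prod_apply hA]
  exact ENNReal.mul_ne_top ENNReal.ofReal_ne_top hfin

end IsEavesdropperNetwork

end

/-! ### The tail integral and the law of the strongest gain -/

section

/-- The integral of `e^(-t ‖x‖^α)` over the complement of the ball of radius `r` in the plane. -/
noncomputable def eveTail (α t r : ℝ) : ℝ :=
  2 * Real.pi * ∫ s in Set.Ioi r, s * Real.exp (-(t * s ^ α))

section Tail

variable {α t : ℝ}

lemma integrableOn_mul_exp_neg_rpow (hα : 0 < α) (ht : 0 < t) :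
    IntegrableOn (fun s : ℝ => s * Real.exp (-(t * s ^ α))) (Set.Ioi 0) := by
  refine (integrableOn_rpow_mul_exp_neg_mul_rpow (s := 1) (by norm_num) hα ht).congr_fun ?_
    measurableSet_Ioi
  intro s _
  simp

lemma eveTail_zero (hα : 0 < α) (ht : 0 < t) :
    eveTail α t 0 = 2 * Real.pi / α * Real.Gamma (2 / α) * t ^ (-(2 / α)) := by
  have h := integral_rpow_mul_exp_neg_mul_rpow (p := α) (q := 1) hα (by norm_num) ht
  simp only [Real.rpow_one, neg_mul] at h
  rw [eveTail, h]
  norm_num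
  rw [neg_div]
  ring

/-- On `[0, ∞)`, `eveTail α t` is its value at `0` minus a primitive. -/
lemma eveTail_eq_sub (hα : 0 < α) (ht : 0 < t) {r : ℝ} (hr : 0 ≤ r) :
    eveTail α t r =
      eveTail α t 0 - 2 * Real.pi * ∫ s in (0 : ℝ)..r, s * Real.exp (-(t * s ^ α)) := by
  have h := intervalIntegral.integral_Ioi_sub_Ioi (integrableOn_mul_exp_neg_rpow hα ht) hr
  rw [← h, eveTail, eveTail]
  ring

lemma continuous_mul_exp_neg_rpow (hα : 0 < α) :
    Continuous fun s : ℝ => s * Real.exp (-(t * s ^ α)) := by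
  have := Real.continuous_rpow_const hα.le
  fun_prop

/-- Used to show that the infimum of the feasible radii is itself feasible. -/
lemma isClosed_setOf_eveTail_le (hα : 0 < α) (ht : 0 < t) (c : ℝ) :
    IsClosed {r : ℝ | 0 ≤ r ∧ eveTail α t r ≤ c} := by
  have hc : Continuous fun r : ℝ => eveTail α t 0 -
      2 * Real.pi * ∫ s in (0 : ℝ)..r, s * Real.exp (-(t * s ^ α)) :=
    continuous_const.sub (continuous_const.mul (intervalIntegral.continuous_primitive
      (fun a b => (continuous_mul_exp_neg_rpow hα).intervalIntegrable a b) 0))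
  have : {r : ℝ | 0 ≤ r ∧ eveTail α t r ≤ c} = Set.Ici 0 ∩ {r | eveTail α t 0 -
      2 * Real.pi * ∫ s in (0 : ℝ)..r, s * Real.exp (-(t * s ^ α)) ≤ c} := by
    ext r
    exact and_congr_right fun hr => by
      rw [eveTail_eq_sub hα ht hr]; rfl
  rw [this]
  exact isClosed_Ici.inter (isClosed_le hc continuous_const)

lemma tendsto_eveTail (hα : 0 < α) (ht : 0 < t) : Tendsto (eveTail α t) atTop (𝓝 0) := by
  have h := intervalIntegral_tendsto_integral_Ioi (0 : ℝ)
    (integrableOn_mul_exp_neg_rpow hα ht) tendsto_id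
  have h' : Tendsto (fun r : ℝ => eveTail α t 0 -
      2 * Real.pi * ∫ s in (0 : ℝ)..r, s * Real.exp (-(t * s ^ α))) atTop (𝓝 0) := by
    have := (h.const_mul (2 * Real.pi)).const_sub (eveTail α t 0)
    simpa [eveTail] using this
  refine h'.congr' ?_
  filter_upwards [eventually_ge_atTop 0] with r hr
  rw [eveTail_eq_sub hα ht hr]

lemma eveTail_nonneg {r : ℝ} (hr : 0 ≤ r) : 0 ≤ eveTail α t r := by
  refine mul_nonneg (by positivity) (setIntegral_nonneg measurableSet_Ioi fun s hs => ?_)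
  have : 0 < s := hr.trans_lt hs
  positivity

lemma setLIntegral_compl_ball_exp (hα : 0 < α) (ht : 0 < t) {r : ℝ} (hr : 0 ≤ r) :
    ∫⁻ x in (Metric.ball (0 : Plane) r)ᶜ, ENNReal.ofReal (Real.exp (-(t * ‖x‖ ^ α))) =
      ENNReal.ofReal (eveTail α t r) := by
  let F : ℝ → ℝ := (Set.Ici r).indicator fun s => Real.exp (-(t * s ^ α))
  have hdim : Module.finrank ℝ Plane = 2 := by simp
  have hF : (fun x : Plane => F ‖x‖) =
      (Metric.ball (0 : Plane) r)ᶜ.indicator fun x => Real.exp (-(t * ‖x‖ ^ α)) := by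
    ext x
    by_cases hx : r ≤ ‖x‖ <;> simp [F, hx, Set.indicator]
  have hI : (fun s : ℝ => s ^ (Module.finrank ℝ Plane - 1) • F s) =
      (Set.Ici r).indicator fun s => s * Real.exp (-(t * s ^ α)) := by
    ext s
    by_cases hs : r ≤ s <;> simp [F, hs, Set.indicator]
  have hint : Integrable (fun x : Plane => F ‖x‖) := by
    rw [integrable_fun_norm_addHaar volume, hI]
    exact (integrableOn_mul_exp_neg_rpow hα ht).indicator measurableSet_Ici
  have hval : ∫ x : Plane, F ‖x‖ = eveTail α t r := by
    have hball : volume.real (Metric.ball (0 : Plane) 1) = Real.pi := by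
      rw [measureReal_def, EuclideanSpace.volume_ball_fin_two]
      simp [Real.pi_pos.le]
    have hset : (Set.Ioi (0 : ℝ) ∩ Set.Ici r : Set ℝ) =ᵐ[volume] Set.Ioi r := by
      have := (ae_eq_refl (Set.Ioi (0 : ℝ))).inter (Ioi_ae_eq_Ici (μ := volume) (a := r)).symm
      rwa [Set.Ioi_inter_Ioi, sup_eq_right.2 hr] at this
    rw [integral_fun_norm_addHaar volume, hI, setIntegral_indicator measurableSet_Ici,
      setIntegral_congr_set hset, hball, hdim, eveTail]
    simp [mul_assoc]
  rw [← hval, ofReal_integral_eq_lintegral_ofReal hint,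
    ← lintegral_indicator measurableSet_ball.compl]
  · refine lintegral_congr fun x => ?_
    rw [congrFun hF x]
    by_cases hx : x ∈ (Metric.ball (0 : Plane) r)ᶜ <;> simp only [Set.indicator, hx, if_true,
      if_false, ENNReal.ofReal_zero]
  · exact ae_of_all _ fun x => Set.indicator_nonneg (fun _ _ => (Real.exp_pos _).le) _

/-- The pairs of a location and a gain that violate either the guard zone of radius `r` or the
bound `t` on the channel gain. -/
def badMarks (α t r : ℝ) : Set (Plane × ℝ) := {p | ‖p.1‖ < r ∨ t < p.2 * ‖p.1‖ ^ (-α)}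

lemma measurableSet_badMarks (α t r : ℝ) : MeasurableSet (badMarks α t r) := by
  exact (measurableSet_lt (f := fun p : Plane × ℝ => ‖p.1‖) (by fun_prop) measurable_const).union
    (measurableSet_lt (g := fun p : Plane × ℝ => p.2 * ‖p.1‖ ^ (-α)) measurable_const
      (by fun_prop))

lemma prod_badMarks (hα : 0 < α) (ht : 0 < t) {r : ℝ} (hr : 0 ≤ r) :
    (volume.prod (expMeasure 1)) (badMarks α t r) =
      ENNReal.ofReal (Real.pi * r ^ 2 + eveTail α t r) := by
  rw [Measure.prod_apply (measurableSet_badMarks α t r),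
    ← lintegral_add_compl _ (measurableSet_ball (x := (0 : Plane)) (ε := r))]
  have hin : ∫⁻ x in Metric.ball (0 : Plane) r,
      expMeasure 1 (Prod.mk x ⁻¹' badMarks α t r) = ENNReal.ofReal (Real.pi * r ^ 2) := by
    have : ∀ x ∈ Metric.ball (0 : Plane) r,
        expMeasure 1 (Prod.mk x ⁻¹' badMarks α t r) = 1 := fun x hx => by
      have : Prod.mk x ⁻¹' badMarks α t r = Set.univ := by
        ext γ
        simpa [badMarks] using Or.inl (by simpa using hx)
      rw [this, measure_univ]
    rw [setLIntegral_congr_fun measurableSet_ball this, setLIntegral_const, one_mul,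
      EuclideanSpace.volume_ball_fin_two, ← ENNReal.ofReal_pow hr,
      ← ENNReal.ofReal_mul (by positivity), mul_comm]
  have hout : ∫⁻ x in (Metric.ball (0 : Plane) r)ᶜ,
      expMeasure 1 (Prod.mk x ⁻¹' badMarks α t r) = ENNReal.ofReal (eveTail α t r) := by
    rw [← setLIntegral_compl_ball_exp hα ht hr]
    refine setLIntegral_congr_fun_ae measurableSet_ball.compl ?_
    -- The origin lies outside the ball when `r = 0`. There `‖x‖ ^ (-α)` takes the default value `0`
    -- and the slice is empty, so this null point is discarded.
    filter_upwards [measure_eq_zero_iff_ae_notMem.1 (measure_singleton (μ := volume) (0 : Plane))]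
      with x hx0 hx
    have hpos : 0 < ‖x‖ := norm_pos_iff.2 hx0
    have hxr : ¬ ‖x‖ < r := by simpa using hx
    have : Prod.mk x ⁻¹' badMarks α t r = Set.Ioi (t * ‖x‖ ^ α) := by
      ext γ
      simp only [badMarks, Set.mem_preimage, Set.mem_ofPred_eq, hxr, false_or, Set.mem_Ioi]
      rw [Real.rpow_neg hpos.le, ← div_eq_mul_inv, lt_div_iff₀ (Real.rpow_pos_of_pos hpos _)]
    rw [this, expMeasure_one_Ioi (by positivity)]
  rw [hin, hout, ENNReal.ofReal_add (by positivity) (eveTail_nonneg hr)]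

end Tail

variable {Ω : Type*}

lemma mem_activeGZ {y : ℕ → Ω → Plane} {r : ℝ} {ω : Ω} :
    ω ∈ activeGZ y r ↔ ∀ i, r ≤ ‖y i ω‖ := by
  simp [activeGZ, pointCount, Set.eq_empty_iff_forall_notMem]

variable [MeasurableSpace Ω] {P : Measure Ω} {lam α : ℝ}
  {y : ℕ → Ω → Plane} {g : ℕ → Ω → ℝ} {h : Ω → ℝ}

namespace IsEavesdropperNetwork

lemma measurableSet_active (hnet : IsEavesdropperNetwork P lam y g h) (r : ℝ) :
    MeasurableSet (activeGZ y r) := by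
  have : activeGZ y r = ⋂ i, {ω | r ≤ ‖y i ω‖} := by
    ext ω; simp [mem_activeGZ]
  rw [this]
  exact MeasurableSet.iInter fun i =>
    measurableSet_le measurable_const (hnet.poisson.measurable i).norm

lemma measureReal_le_h (hnet : IsEavesdropperNetwork P lam y g h) {c : ℝ} (hc : 0 ≤ c) :
    P.real {ω | c ≤ h ω} = Real.exp (-c) := by
  rw [hnet.hasLaw_h.measureReal_eq (p := fun x => c ≤ x) measurableSet_Ici, measureReal_def]
  change (expMeasure 1 (Set.Ici c)).toReal = _
  rw [expMeasure_one_Ici hc, ENNReal.toReal_ofReal (Real.exp_pos _).le]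

lemma ae_gain_nonneg (hnet : IsEavesdropperNetwork P lam y g h) :
    ∀ᵐ ω ∂P, ∀ i, 0 ≤ eveGain α y g i ω := by
  refine ae_all_iff.2 fun i => ?_
  have : ∀ᵐ x ∂(expMeasure 1), x ∈ Set.Ici (0 : ℝ) := by
    refine (mem_ae_iff_prob_eq_one measurableSet_Ici).2 ?_
    simp [expMeasure_one_Ici le_rfl]
  filter_upwards [((hnet.hasLaw_g i).ae_iff (p := fun x => x ∈ Set.Ici (0 : ℝ))
    (measurableSet_setOfPred.1 measurableSet_Ici)).2 this] with ω hω
  exact mul_nonneg hω (by positivity)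

variable [IsProbabilityMeasure P]

lemma measureReal_active_inter_le (hα : 0 < α) (hlam : 0 < lam)
    (hnet : IsEavesdropperNetwork P lam y g h) {t r : ℝ} (ht : 0 < t) (hr : 0 ≤ r) :
    P.real (activeGZ y r ∩ {ω | ∀ i, eveGain α y g i ω ≤ t}) =
      Real.exp (-(lam * (Real.pi * r ^ 2 + eveTail α t r))) := by
  have hset : activeGZ y r ∩ {ω | ∀ i, eveGain α y g i ω ≤ t} =
      {ω | ∀ i, (y i ω, g i ω) ∉ badMarks α t r} := by
    ext ω
    simp [mem_activeGZ, badMarks, eveGain, forall_and]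
  have hnn : 0 ≤ Real.pi * r ^ 2 + eveTail α t r := add_nonneg (by positivity) (eveTail_nonneg hr)
  rw [hset, measureReal_def, hnet.measure_forall_notMem hlam.le (measurableSet_badMarks α t r),
    prod_badMarks hα ht hr, ← ENNReal.ofReal_mul hlam.le, expNeg_ofReal (by positivity),
    ENNReal.toReal_ofReal (Real.exp_pos _).le]

lemma measureReal_active (hlam : 0 < lam) (hnet : IsEavesdropperNetwork P lam y g h) {r : ℝ}
    (hr : 0 ≤ r) : P.real (activeGZ y r) = Real.exp (-(lam * (Real.pi * r ^ 2))) := by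
  have hset : activeGZ y r =
      {ω | ∀ i, (y i ω, g i ω) ∉ Metric.ball (0 : Plane) r ×ˢ (Set.univ : Set ℝ)} := by
    ext ω
    simp [mem_activeGZ]
  rw [hset, measureReal_def,
    hnet.measure_forall_notMem hlam.le (measurableSet_ball.prod MeasurableSet.univ),
    Measure.prod_prod, measure_univ, mul_one, EuclideanSpace.volume_ball_fin_two,
    ← ENNReal.ofReal_pow hr, ← ENNReal.ofReal_mul (by positivity), ← ENNReal.ofReal_mul hlam.le,
    expNeg_ofReal (by positivity), ENNReal.toReal_ofReal (Real.exp_pos _).le, mul_comm (r ^ 2)]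

/-- Almost surely, some eavesdropper is the strongest. -/
lemma ae_exists_isMax (hα : 0 < α) (hlam : 0 < lam) (hnet : IsEavesdropperNetwork P lam y g h) :
    ∀ᵐ ω ∂P, ∃ i, ∀ j, eveGain α y g j ω ≤ eveGain α y g i ω := by
  -- At radius `0` only the gain condition of `badMarks` remains. Almost surely, then, only finitely
  -- many gains exceed any `1 / (n + 1)`, and a positive gain leaves only a finite set to maximize
  -- over.
  have hfin : ∀ᵐ ω ∂P, ∀ n : ℕ,
      {i | (y i ω, g i ω) ∈ badMarks α (1 / ((n : ℝ) + 1)) 0}.Finite := by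
    refine ae_all_iff.2 fun n => hnet.ae_finite_setOf_mem hlam.le (measurableSet_badMarks _ _ _) ?_
    rw [prod_badMarks hα (by positivity) le_rfl]
    exact ENNReal.ofReal_ne_top
  filter_upwards [hfin, hnet.ae_gain_nonneg (α := α)] with ω hω hnn
  by_cases hzero : ∀ i, eveGain α y g i ω ≤ 0
  · exact ⟨0, fun j => (hzero j).trans (hnn 0)⟩
  push Not at hzero
  obtain ⟨i, hi⟩ := hzero
  obtain ⟨n, hn⟩ := exists_nat_one_div_lt hi
  have hmem (j : ℕ) : j ∈ {i | (y i ω, g i ω) ∈ badMarks α (1 / ((n : ℝ) + 1)) 0} ↔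
      1 / ((n : ℝ) + 1) < eveGain α y g j ω := by
    simp [badMarks, eveGain, (norm_nonneg _).not_gt]
  obtain ⟨m, hm, hmax⟩ := Set.exists_max_image _ (fun j => eveGain α y g j ω) (hω n)
    ⟨i, (hmem i).2 hn⟩
  refine ⟨m, fun j => ?_⟩
  by_cases hj : 1 / ((n : ℝ) + 1) < eveGain α y g j ω
  · exact hmax j ((hmem j).2 hj)
  · exact (not_lt.1 hj).trans ((hmem m).1 hm).le

/-- Once the maximum exists, the arbitrary choice in `strongest` does attain it. A single null set
serves all levels `t`. -/
lemma ae_strongestGain (hα : 0 < α) (hlam : 0 < lam) (hnet : IsEavesdropperNetwork P lam y g h) :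
    ∀ᵐ ω ∂P, 0 ≤ strongestGain α y g ω ∧
      ∀ t, strongestGain α y g ω ≤ t ↔ ∀ i, eveGain α y g i ω ≤ t := by
  filter_upwards [hnet.ae_exists_isMax hα hlam, hnet.ae_gain_nonneg (α := α)] with ω hω hnn
  have hmax : ∀ j, eveGain α y g j ω ≤ strongestGain α y g ω := Classical.epsilon_spec hω
  exact ⟨hnn _, fun t => ⟨fun ht j => (hmax j).trans ht, fun ht => ht _⟩⟩

lemma measureReal_active_inter_strongestGain_le (hα : 0 < α) (hlam : 0 < lam)
    (hnet : IsEavesdropperNetwork P lam y g h) {t r : ℝ} (ht : 0 < t) (hr : 0 ≤ r) :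
    P.real (activeGZ y r ∩ {ω | strongestGain α y g ω ≤ t}) =
      Real.exp (-(lam * (Real.pi * r ^ 2 + eveTail α t r))) := by
  rw [← hnet.measureReal_active_inter_le hα hlam ht hr]
  refine measureReal_congr ?_
  filter_upwards [hnet.ae_strongestGain hα hlam] with ω hω
  exact propext (and_congr_right fun _ => hω.2 t)

lemma measureReal_strongestGain_le (hα : 0 < α) (hlam : 0 < lam)
    (hnet : IsEavesdropperNetwork P lam y g h) {t : ℝ} (ht : 0 < t) :
    P.real {ω | strongestGain α y g ω ≤ t} = Real.exp (-(lam * eveTail α t 0)) := by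
  have h0 : activeGZ y 0 = Set.univ := Set.eq_univ_of_forall fun ω => by simp [mem_activeGZ]
  simpa [h0] using hnet.measureReal_active_inter_strongestGain_le hα hlam ht le_rfl

lemma measureReal_le_h_inter_active (hlam : 0 < lam) (hnet : IsEavesdropperNetwork P lam y g h)
    {c r : ℝ} (hc : 0 ≤ c) (hr : 0 ≤ r) :
    P.real ({ω | c ≤ h ω} ∩ activeGZ y r) =
      Real.exp (-c) * Real.exp (-(lam * (Real.pi * r ^ 2))) := by
  let D : Set ((ℕ → ℝ) × (ℕ → Plane)) := {p | ∀ i, r ≤ ‖p.2 i‖}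
  have hD : MeasurableSet D := by
    have : D = ⋂ i, {p | r ≤ ‖p.2 i‖} := by ext p; simp [D]
    rw [this]
    exact MeasurableSet.iInter fun i => measurableSet_le (by fun_prop) (by fun_prop)
  have hact : activeGZ y r = (fun ω => ((fun i => g i ω), (fun i => y i ω))) ⁻¹' D := by
    ext ω
    exact mem_activeGZ
  have := hnet.indep_h.measure_inter_preimage_eq_mul _ _ (measurableSet_Ici (a := c)) hD
  change P ({ω | c ≤ h ω} ∩ _) = P {ω | c ≤ h ω} * _ at this
  rw [← hact] at this
  rw [← hnet.measureReal_le_h hc, ← hnet.measureReal_active hlam hr, measureReal_def,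
    measureReal_def, measureReal_def, ← ENNReal.toReal_mul, ← this]

end IsEavesdropperNetwork

end

/-! ### The density threshold -/

section Threshold

variable {α ε lam : ℝ}

lemma le_exp_neg_iff {x : ℝ} (hε : 0 < ε) : ε ≤ Real.exp (-x) ↔ x ≤ Real.log (1 / ε) := by
  rw [← Real.log_le_iff_le_exp hε, one_div, Real.log_inv, le_neg]

lemma lt_exp_neg_iff {x : ℝ} (hε : 0 < ε) : ε < Real.exp (-x) ↔ x < Real.log (1 / ε) := by
  rw [← Real.log_lt_iff_lt_exp hε, one_div, Real.log_inv, lt_neg]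

lemma densityThreshold_eq {Pt σS βe : ℝ} (hPt : 0 < Pt) (hσS : 0 < σS) (hβe : 0 < βe) :
    densityThreshold Pt σS α βe ε =
      α / (2 * Real.pi * Real.Gamma (2 / α)) * Real.log (1 / ε) *
        (βe * σS ^ 2 / Pt) ^ (2 / α) := by
  have : Pt / (σS ^ 2 * βe) = (βe * σS ^ 2 / Pt)⁻¹ := by rw [inv_div, mul_comm]
  rw [densityThreshold, this, Real.inv_rpow (by positivity), Real.rpow_neg (by positivity),
    inv_inv]

lemma mul_eveTail_zero_eq {t : ℝ} (hα : 0 < α) (ht : 0 < t) (hL : 0 < Real.log (1 / ε)) :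
    lam * eveTail α t 0 = Real.log (1 / ε) * (lam /
      (α / (2 * Real.pi * Real.Gamma (2 / α)) * Real.log (1 / ε) * t ^ (2 / α))) := by
  have hΓ : 0 < Real.Gamma (2 / α) := Real.Gamma_pos_of_pos (by positivity)
  have htp : 0 < t ^ (2 / α) := Real.rpow_pos_of_pos ht _
  rw [eveTail_zero hα ht, Real.rpow_neg ht.le]
  field_simp

lemma mul_eveTail_zero_le_iff {t : ℝ} (hα : 0 < α) (ht : 0 < t) (hL : 0 < Real.log (1 / ε)) :
    lam * eveTail α t 0 ≤ Real.log (1 / ε) ↔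
      lam ≤ α / (2 * Real.pi * Real.Gamma (2 / α)) * Real.log (1 / ε) * t ^ (2 / α) := by
  have hΓ : 0 < Real.Gamma (2 / α) := Real.Gamma_pos_of_pos (by positivity)
  have htp : 0 < t ^ (2 / α) := Real.rpow_pos_of_pos ht _
  rw [mul_eveTail_zero_eq hα ht hL, mul_le_iff_le_one_right hL, div_le_one (by positivity)]

lemma mul_eveTail_zero_lt_iff {t : ℝ} (hα : 0 < α) (ht : 0 < t) (hL : 0 < Real.log (1 / ε)) :
    lam * eveTail α t 0 < Real.log (1 / ε) ↔
      lam < α / (2 * Real.pi * Real.Gamma (2 / α)) * Real.log (1 / ε) * t ^ (2 / α) := by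
  have hΓ : 0 < Real.Gamma (2 / α) := Real.Gamma_pos_of_pos (by positivity)
  have htp : 0 < t ^ (2 / α) := Real.rpow_pos_of_pos ht _
  rw [mul_eveTail_zero_eq hα ht hL, mul_lt_iff_lt_one_right hL, div_lt_one (by positivity)]

/-- Secrecy holds at the level `t` of the strongest gain exactly when `t` is at least some
positive number. -/
lemma exists_gain_threshold (hα : 0 < α) (hlam : 0 < lam) (hL : 0 < Real.log (1 / ε)) :
    ∃ T > 0, ∀ t > 0, lam * eveTail α t 0 ≤ Real.log (1 / ε) ↔ T ≤ t := by
  have hΓ : 0 < Real.Gamma (2 / α) := Real.Gamma_pos_of_pos (by positivity)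
  set c := α / (2 * Real.pi * Real.Gamma (2 / α)) * Real.log (1 / ε) with hc
  have hcpos : 0 < c := by positivity
  -- The condition reads `lam ≤ c * t ^ (2 / α)`; this is its solution for `t`.
  refine ⟨(lam / c) ^ (α / 2), by positivity, fun t ht => ?_⟩
  rw [mul_eveTail_zero_le_iff hα ht hL, ← hc, ← div_le_iff₀' hcpos,
    ← Real.le_rpow_inv_iff_of_pos (by positivity) ht.le (by positivity), inv_div]

end Threshold

/-- Maximizing a strictly decreasing function over `F` amounts to finding the least element. -/
lemma maximizer_iff_isLeast {F : Set ℝ} {f : ℝ → ℝ} (hf : StrictAntiOn f F) {r : ℝ} :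
    (r ∈ F ∧ ∀ r' ∈ F, f r' ≤ f r) ↔ IsLeast F r :=
  and_congr_right fun hr => forall₂_congr fun _ hr' => hf.le_iff_ge hr' hr

/-- Maximizing a strictly increasing function over `F` amounts to finding the greatest element. -/
lemma maximizer_iff_isGreatest {F : Set ℝ} {f : ℝ → ℝ} (hf : StrictMonoOn f F) {r : ℝ} :
    (r ∈ F ∧ ∀ r' ∈ F, f r' ≤ f r) ↔ IsGreatest F r :=
  and_congr_right fun hr => forall₂_congr fun _ hr' => hf.le_iff_le hr' hr

/-! ### Coverage and secrecy probabilities of the two techniques -/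

section

variable {Ω : Type*} {Pt σP σS α d βt βe ε lam : ℝ} {y : ℕ → Ω → Plane} {g : ℕ → Ω → ℝ} {h : Ω → ℝ}

lemma snrS_AN_le_iff {γ : ℝ} (hPt : 0 < Pt) (hσS : 0 < σS) (hγ : γ ≤ 1) {ω : Ω}
    (hω : 0 ≤ strongestGain α y g ω) :
    snrS_AN Pt σS α y g γ ω ≤ βe ↔
      (γ * (1 + βe) - βe) * strongestGain α y g ω ≤ βe * σS ^ 2 / Pt := by
  have h1 : 0 ≤ 1 - γ := sub_nonneg.2 hγ
  rw [snrS_AN, div_le_iff₀ (by positivity), le_div_iff₀ hPt]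
  constructor <;> intro h <;> linarith

variable [MeasurableSpace Ω] {P : Measure Ω}

namespace IsEavesdropperNetwork

lemma covAN_zero (hβt : 0 < βt) : covAN P Pt σP α d βt h 0 = 0 := by
  simp [covAN, snrP_AN, hβt.not_ge]

lemma covAN_eq (hPt : 0 < Pt) (hσP : 0 < σP) (hd : 0 < d) (hβt : 0 < βt)
    (hnet : IsEavesdropperNetwork P lam y g h) {γ : ℝ} (hγ : 0 < γ) :
    covAN P Pt σP α d βt h γ = Real.exp (-(βt * σP ^ 2 / (γ * (Pt * d ^ (-α))))) := by
  have hset : {ω | βt ≤ snrP_AN Pt σP α d h γ ω} =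
      {ω | βt * σP ^ 2 / (γ * (Pt * d ^ (-α))) ≤ h ω} := by
    ext ω
    simp only [snrP_AN, Set.mem_ofPred_eq]
    rw [le_div_iff₀ (by positivity), div_le_iff₀ (by positivity),
      show γ * Pt * h ω * d ^ (-α) = h ω * (γ * (Pt * d ^ (-α))) by ring]
  rw [covAN, hset, hnet.measureReal_le_h (by positivity)]

lemma strictMonoOn_covAN (hPt : 0 < Pt) (hσP : 0 < σP) (hd : 0 < d) (hβt : 0 < βt)
    (hnet : IsEavesdropperNetwork P lam y g h) :
    StrictMonoOn (covAN P Pt σP α d βt h) (Set.Ici 0) := by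
  intro r hr s _ hrs
  have hr0 : 0 ≤ r := hr
  rw [hnet.covAN_eq hPt hσP hd hβt (hr0.trans_lt hrs)]
  -- The closed form fails at `γ = 0`: division by zero would make it `1`, whereas the coverage
  -- there is `0`.
  rcases hr0.eq_or_lt with rfl | hr0
  · rw [covAN_zero hβt]
    exact Real.exp_pos _
  · rw [hnet.covAN_eq hPt hσP hd hβt hr0]
    gcongr

variable [IsProbabilityMeasure P]

lemma secGZ_eq (hα : 0 < α) (hlam : 0 < lam) (hPt : 0 < Pt) (hσS : 0 < σS) (hβe : 0 < βe)
    (hnet : IsEavesdropperNetwork P lam y g h) {r : ℝ} (hr : 0 ≤ r) :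
    secGZ P Pt σS α βe y g r = Real.exp (-(lam * eveTail α (βe * σS ^ 2 / Pt) r)) := by
  have hset : {ω | snrS_GZ Pt σS α y g ω ≤ βe} =
      {ω | strongestGain α y g ω ≤ βe * σS ^ 2 / Pt} := by
    ext ω
    simp only [snrS_GZ, Set.mem_ofPred_eq]
    rw [div_le_iff₀ (by positivity), le_div_iff₀' hPt]
  rw [secGZ, hset, measureReal_def, cond_apply (hnet.measurableSet_active r), ENNReal.toReal_mul,
    ENNReal.toReal_inv, ← measureReal_def, ← measureReal_def, hnet.measureReal_active hlam hr,
    hnet.measureReal_active_inter_strongestGain_le hα hlam (by positivity) hr, ← Real.exp_neg,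
    ← Real.exp_add]
  congr 1; ring

lemma covGZ_eq (hlam : 0 < lam) (hPt : 0 < Pt) (hσP : 0 < σP) (hd : 0 < d) (hβt : 0 < βt)
    (hnet : IsEavesdropperNetwork P lam y g h) {r : ℝ} (hr : 0 ≤ r) :
    covGZ P Pt σP α d βt y h r = Real.exp (-(βt * σP ^ 2 / (Pt * d ^ (-α)))) *
      Real.exp (-(lam * (Real.pi * r ^ 2))) := by
  have hset : {ω | βt ≤ snrP_GZ Pt σP α d h ω} = {ω | βt * σP ^ 2 / (Pt * d ^ (-α)) ≤ h ω} := by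
    ext ω
    simp only [snrP_GZ, Set.mem_ofPred_eq]
    rw [le_div_iff₀ (by positivity), div_le_iff₀ (by positivity),
      show Pt * h ω * d ^ (-α) = h ω * (Pt * d ^ (-α)) by ring]
  rw [covGZ, hset, hnet.measureReal_le_h_inter_active hlam (by positivity) hr]

lemma strictAntiOn_covGZ (hlam : 0 < lam) (hPt : 0 < Pt) (hσP : 0 < σP) (hd : 0 < d) (hβt : 0 < βt)
    (hnet : IsEavesdropperNetwork P lam y g h) :
    StrictAntiOn (covGZ P Pt σP α d βt y h) (Set.Ici 0) := by
  intro r hr s hs hrs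
  rw [hnet.covGZ_eq hlam hPt hσP hd hβt hr, hnet.covGZ_eq hlam hPt hσP hd hβt hs]
  have hr0 : 0 ≤ r := hr
  gcongr

lemma secAN_eq_one (hα : 0 < α) (hlam : 0 < lam) (hPt : 0 < Pt) (hσS : 0 < σS) (hβe : 0 < βe)
    (hnet : IsEavesdropperNetwork P lam y g h) {γ : ℝ} (hγ1 : γ ≤ 1) (hγ : γ * (1 + βe) ≤ βe) :
    secAN P Pt σS α βe y g γ = 1 := by
  have : {ω | snrS_AN Pt σS α y g γ ω ≤ βe} =ᵐ[P] (Set.univ : Set Ω) := by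
    filter_upwards [hnet.ae_strongestGain hα hlam] with ω hω
    refine propext (iff_of_true ?_ trivial)
    refine (snrS_AN_le_iff hPt hσS hγ1 hω.1).2 ?_
    exact (mul_nonpos_of_nonpos_of_nonneg (by linarith) hω.1).trans (by positivity)
  rw [secAN, measureReal_congr this, probReal_univ]

lemma secAN_eq (hα : 0 < α) (hlam : 0 < lam) (hPt : 0 < Pt) (hσS : 0 < σS) (hβe : 0 < βe)
    (hnet : IsEavesdropperNetwork P lam y g h) {γ : ℝ} (hγ1 : γ ≤ 1) (hγ : βe < γ * (1 + βe)) :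
    secAN P Pt σS α βe y g γ =
      Real.exp (-(lam * eveTail α (βe * σS ^ 2 / Pt / (γ * (1 + βe) - βe)) 0)) := by
  have hu : 0 < γ * (1 + βe) - βe := sub_pos.2 hγ
  rw [← hnet.measureReal_strongestGain_le hα hlam (by positivity), secAN]
  refine measureReal_congr ?_
  filter_upwards [hnet.ae_strongestGain hα hlam] with ω hω
  refine propext ((snrS_AN_le_iff hPt hσS hγ1 hω.1).trans ?_)
  rw [← le_div_iff₀' hu]
  rfl

/-- The feasible power splits form an interval. -/
lemma exists_le_secAN_iff (hα : 0 < α) (hlam : 0 < lam) (hPt : 0 < Pt) (hσS : 0 < σS)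
    (hβe : 0 < βe) (hε : 0 < ε) (hε1 : ε < 1) (hnet : IsEavesdropperNetwork P lam y g h) :
    ∃ γ₀ > 0, ∀ γ ≤ 1, ε ≤ secAN P Pt σS α βe y g γ ↔ γ ≤ γ₀ := by
  have hL : 0 < Real.log (1 / ε) := Real.log_pos (by rwa [one_lt_div hε])
  obtain ⟨T, hT, hTiff⟩ := exists_gain_threshold hα hlam hL
  -- For `u = γ * (1 + βe) - βe > 0`, secrecy requires the gain level `S / u` to be at least `T`,
  -- that is `u ≤ S / T`; solving for `γ` gives this bound. Splits with `u ≤ 0` lie below it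
  -- automatically.
  refine ⟨(βe * σS ^ 2 / Pt / T + βe) / (1 + βe), by positivity, fun γ hγ1 => ?_⟩
  rw [le_div_iff₀ (by positivity)]
  rcases le_or_gt (γ * (1 + βe)) βe with hγ | hγ
  · rw [hnet.secAN_eq_one hα hlam hPt hσS hβe hγ1 hγ]
    have : 0 < βe * σS ^ 2 / Pt / T := by positivity
    exact iff_of_true hε1.le (by linarith)
  · have hu : 0 < γ * (1 + βe) - βe := sub_pos.2 hγ
    rw [hnet.secAN_eq hα hlam hPt hσS hβe hγ1 hγ, le_exp_neg_iff hε,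
      hTiff _ (by positivity), le_div_comm₀ hT hu, sub_le_iff_le_add]

lemma secAN_one (hα : 0 < α) (hlam : 0 < lam) (hPt : 0 < Pt) (hσS : 0 < σS) (hβe : 0 < βe)
    (hnet : IsEavesdropperNetwork P lam y g h) :
    secAN P Pt σS α βe y g 1 = Real.exp (-(lam * eveTail α (βe * σS ^ 2 / Pt) 0)) := by
  rw [hnet.secAN_eq hα hlam hPt hσS hβe le_rfl (by linarith)]
  simp

end IsEavesdropperNetwork

end

/-! ### The optimal radius, the optimal split and their common threshold -/

theorem mainTheorem5 {Ω : Type*} [MeasurableSpace Ω] (P : Measure Ω) [IsProbabilityMeasure P]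
    (Pt σP σS α d βt βe ε lam : ℝ)
    (hPt : 0 < Pt) (hσP : 0 < σP) (hσS : 0 < σS) (hα : 2 < α) (hd : 0 < d)
    (hβt : 0 < βt) (hβe : 0 < βe) (hε : 0 < ε) (hε1 : ε < 1) (hlam : 0 < lam)
    (y : ℕ → Ω → Plane) (g : ℕ → Ω → ℝ) (h : Ω → ℝ)
    (hnet : IsEavesdropperNetwork P lam y g h) :
    -- guard zone: the optimal radius exists, is unique, and is `0` exactly up to the threshold
    (∃! r, IsOptimalRadius P Pt σP σS α d βt βe ε y g h r) ∧
    (∀ r, IsOptimalRadius P Pt σP σS α d βt βe ε y g h r →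
      (r = 0 ↔ lam ≤ densityThreshold Pt σS α βe ε)) ∧
    -- artificial noise: the optimal split exists, is unique, and is `1` exactly up to the threshold
    (∃! γ, IsOptimalSplit P Pt σP σS α d βt βe ε y g h γ) ∧
    (∀ γ, IsOptimalSplit P Pt σP σS α d βt βe ε y g h γ →
      (γ = 1 ↔ lam ≤ densityThreshold Pt σS α βe ε)) ∧
    -- the secrecy target is met without either technique
    (lam ≤ densityThreshold Pt σS α βe ε →
      ε ≤ secGZ P Pt σS α βe y g 0 ∧ ε ≤ secAN P Pt σS α βe y g 1) ∧
    (lam < densityThreshold Pt σS α βe ε →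
      ε < secGZ P Pt σS α βe y g 0 ∧ ε < secAN P Pt σS α βe y g 1) := by
  have hα0 : 0 < α := by linarith
  have hS : 0 < βe * σS ^ 2 / Pt := by positivity
  have hL : 0 < Real.log (1 / ε) := Real.log_pos (by rwa [one_lt_div hε])
  have hsec0 := hnet.secGZ_eq hα0 hlam hPt hσS hβe le_rfl
  have hsec1 := hnet.secAN_one hα0 hlam hPt hσS hβe
  have hthr : ε ≤ Real.exp (-(lam * eveTail α (βe * σS ^ 2 / Pt) 0)) ↔
      lam ≤ densityThreshold Pt σS α βe ε := by
    rw [le_exp_neg_iff hε, mul_eveTail_zero_le_iff hα0 hS hL, densityThreshold_eq hPt hσS hβe]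
  have hthr' : ε < Real.exp (-(lam * eveTail α (βe * σS ^ 2 / Pt) 0)) ↔
      lam < densityThreshold Pt σS α βe ε := by
    rw [lt_exp_neg_iff hε, mul_eveTail_zero_lt_iff hα0 hS hL, densityThreshold_eq hPt hσS hβe]
  -- the feasible radii
  let F : Set ℝ := {r | 0 ≤ r ∧ ε ≤ secGZ P Pt σS α βe y g r}
  have hF : F = {r | 0 ≤ r ∧ eveTail α (βe * σS ^ 2 / Pt) r ≤ Real.log (1 / ε) / lam} := by
    ext r
    refine and_congr_right fun hr => ?_
    rw [hnet.secGZ_eq hα0 hlam hPt hσS hβe hr, le_exp_neg_iff hε, le_div_iff₀' hlam]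
  have hGZ (r : ℝ) : IsOptimalRadius P Pt σP σS α d βt βe ε y g h r ↔ IsLeast F r := by
    rw [← maximizer_iff_isLeast
      ((hnet.strictAntiOn_covGZ (α := α) hlam hPt hσP hd hβt).mono fun r hr => hr.1)]
    exact and_congr_right fun _ => forall_congr' fun r' => and_imp.symm
  have hFne : F.Nonempty := by
    obtain ⟨r, hr0, hr⟩ := ((eventually_ge_atTop 0).and
      ((tendsto_eveTail hα0 hS).eventually_le_const (div_pos hL hlam))).exists
    exact ⟨r, hF ▸ ⟨hr0, hr⟩⟩
  have hFbdd : BddBelow F := ⟨0, fun r hr => hr.1⟩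
  -- The feasible set is closed, bounded below, and nonempty because `eveTail` tends to `0`.
  have hleast : IsLeast F (sInf F) :=
    ⟨(hF ▸ isClosed_setOf_eveTail_le hα0 hS _ : IsClosed F).csInf_mem hFne hFbdd,
      fun r hr => csInf_le hFbdd hr⟩
  -- the feasible power splits
  obtain ⟨γ₀, hγ₀, hγ₀iff⟩ := hnet.exists_le_secAN_iff hα0 hlam hPt hσS hβe hε hε1
  let G : Set ℝ := {γ | γ ∈ Set.Icc (0 : ℝ) 1 ∧ ε ≤ secAN P Pt σS α βe y g γ}
  have hAN (γ : ℝ) : IsOptimalSplit P Pt σP σS α d βt βe ε y g h γ ↔ IsGreatest G γ := by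
    rw [← maximizer_iff_isGreatest
      ((hnet.strictMonoOn_covAN (α := α) hPt hσP hd hβt).mono fun γ hγ => hγ.1.1)]
    exact and_congr_right fun _ => forall_congr' fun γ' => and_imp.symm
  have hgreatest : IsGreatest G (min 1 γ₀) :=
    ⟨⟨⟨le_min zero_le_one hγ₀.le, min_le_left _ _⟩,
      (hγ₀iff _ (min_le_left _ _)).2 (min_le_right _ _)⟩,
      fun γ hγ => le_min hγ.1.2 ((hγ₀iff _ hγ.1.2).1 hγ.2)⟩
  refine ⟨⟨sInf F, (hGZ _).2 hleast, fun r hr => ((hGZ r).1 hr).unique hleast⟩, fun r hr => ?_,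
    ⟨min 1 γ₀, (hAN _).2 hgreatest, fun γ hγ => ((hAN γ).1 hγ).unique hgreatest⟩, fun γ hγ => ?_,
    fun hle => ?_, fun hlt => ?_⟩
  · rw [hGZ] at hr
    rw [← hthr, ← hsec0]
    -- The least element of a set of nonnegative radii is `0` exactly when `0` belongs to the set.
    exact ⟨fun h0 => h0 ▸ hr.1.2, fun h0 => le_antisymm (hr.2 ⟨le_rfl, h0⟩) hr.1.1⟩
  · rw [hAN] at hγ
    rw [← hthr, ← hsec1]
    exact ⟨fun h1 => h1 ▸ hγ.1.2,
      fun h1 => le_antisymm hγ.1.1.2 (hγ.2 ⟨⟨zero_le_one, le_rfl⟩, h1⟩)⟩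
  · rw [hsec0, hsec1]
    exact ⟨hthr.2 hle, hthr.2 hle⟩
  · rw [hsec0, hsec1]
    exact ⟨hthr'.2 hlt, hthr'.2 hlt⟩
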